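/- Let $n\ge 1$ and $[n]=\{1,\dots,n\}$. A multi-pointed partition of $[n]$ is a partition of $[n]$ together with the choice of a non-empty subset (the pointed subset) of each block. Let $\mathrm{M}\Pi^A_n$ be the set of multi-pointed partitions of $[n]$, partially ordered by the reflexive-transitive closure of the following relation: $\nu$ is obtained from $\pi$ by merging two blocks $B_1,B_2$ of $\pi$ with pointed subsets $S_1,S_2$ into one block $B_1\cup B_2$ whose pointed subset is $S_1$, $S_2$ or $S_1\cup S_2$, all other blocks and their pointed subsets being unchanged. Its least element $\hat 0$ is the partition into singletons. For $1\le i\le n$, let $\mathrm{M}\Pi^{A'}_{n,i}=[\hat 0,V]$, where $V$ is any multi-pointed partition with a single block and exactly $i$ pointed elements. A finite poset is semi-modular if it is bounded and any two distinct elements covering a common element are themselves covered by a common element; it is totally semi-modular if it is bounded and all its closed intervals are semi-modular. A finite poset is graded if it is bounded and, for all $x\le y$, all maximal chains of $[x,y]$ have the same length. A chain-edge labeling of a finite graded poset assigns a label in some poset to each pair consisting of a maximal chain $x_0\lessdot x_1\lessdot\cdots\lessdot x_m$ and an edge $x_{j-1}\lessdot x_j$ of it, the label depending only on $x_0,\dots,x_j$.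 It is a CL-labeling if, for all $x\le y$ and every maximal chain $r$ of $[\hat 0,x]$, exactly one maximal chain of $[x,y]$ has a weakly increasing sequence of labels (computed with the root $r$), and that sequence is lexicographically strictly smaller than the sequence of every other maximal chain of $[x,y]$ (also computed with the root $r$). The poset is CL-shellable if it is graded and has a CL-labeling. A finite graded poset is Cohen–Macaulay over $\mathbb K$ if, for all $x<y$, the reduced simplicial homology with coefficients in $\mathbb K$ of the order complex of the open interval $(x,y)$ vanishes except in dimension $\ell-2$, where $\ell$ is the length of the maximal chains of $[x,y]$. Theorem. For all $1\le i\le n$, the poset $\mathrm{M}\Pi^{A'}_{n,i}$ is totally semi-modular, CL-shellable, and Cohen–Macaulay over $\mathbb Z$ and over every field. -/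

import Mathlib

/-! ### Bounded, pure, semi-modular, CL-shellable and Cohen-Macaulay finite posets -/

/-- The poset has a least element and a greatest element. -/
def IsBoundedPoset (P : Type*) [PartialOrder P] : Prop :=
  (∃ a : P, IsBot a) ∧ ∃ b : P, IsTop b

/-- `IsSaturatedChain x c y`: writing `c = [x₁, …, xₖ]`, one has `x ⋖ x₁ ⋖ ⋯ ⋖ xₖ = y`
(and `x = y` if `c` is empty). For finite posets these are exactly the maximal chains of
the closed interval `[x, y]`, written without their first element. -/
def IsSaturatedChain {P : Type*} [PartialOrder P] (x : P) (c : List P) (y : P) : Prop :=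
  List.IsChain (· ⋖ ·) (x :: c) ∧ (x :: c).getLast (List.cons_ne_nil x c) = y

/-- For all `x ≤ y`, all maximal chains between `x` and `y` have the same length. -/
def IsPurePoset (P : Type*) [PartialOrder P] : Prop :=
  ∀ (x y : P) (c c' : List P),
    IsSaturatedChain x c y → IsSaturatedChain x c' y → c.length = c'.length

/-- A graded poset is a bounded and pure (finite) poset. -/
def IsGradedPoset (P : Type*) [PartialOrder P] : Prop :=
  IsBoundedPoset P ∧ IsPurePoset P

/-- A finite poset is semi-modular if it is bounded and any two distinct elements covering
a common element are covered by a common element. -/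
def IsSemimodularPoset (P : Type*) [PartialOrder P] : Prop :=
  IsBoundedPoset P ∧
    ∀ t u v : P, t ⋖ u → t ⋖ v → u ≠ v → ∃ z : P, u ⋖ z ∧ v ⋖ z

/-- A finite poset is totally semi-modular if it is bounded and all its closed intervals
are semi-modular. -/
def IsTotallySemimodularPoset (P : Type*) [PartialOrder P] : Prop :=
  IsBoundedPoset P ∧ ∀ x y : P, x ≤ y → IsSemimodularPoset (Set.Icc x y)

/-- A chain-edge labeling assigns a label to every pair (maximal chain `m`, edge of `m`), in
such a way that the label of the `i`-th edge depends only on the first `i` edges of `m`. It is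
thus a function on the saturated chains `0̂ ⋖ x₁ ⋖ ⋯ ⋖ xᵢ` (recorded as `[x₁, …, xᵢ]`), whose
value is the label of the edge `xᵢ₋₁ ⋖ xᵢ` in any maximal chain beginning in that way.

`labelWord lam r c` is the word of labels read along the chain `c` above the root `r`. -/
def labelWord {P L : Type*} (lam : List P → L) : List P → List P → List L
  | _, [] => []
  | r, y :: c => lam (r ++ [y]) :: labelWord lam (r ++ [y]) c

/-- `lam` is a CL-labeling: in every rooted interval `[x, y]_r` (`r` being a saturated chain
from the least element `bot` to `x`) there is a unique maximal chain with weakly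
increasing label word, and its label word lexicographically precedes
the label words of all other maximal chains of `[x, y]_r`. -/
def IsCLLabeling {P L : Type*} [PartialOrder P] [PartialOrder L] (bot : P)
    (lam : List P → L) : Prop :=
  ∀ (x y : P) (r : List P), x ≤ y → IsSaturatedChain bot r x →
    ∃ a : List P, IsSaturatedChain x a y ∧
      List.IsChain (· ≤ ·) (labelWord lam r a) ∧
      ∀ c : List P, IsSaturatedChain x c y → c ≠ a →
        ¬ List.IsChain (· ≤ ·) (labelWord lam r c) ∧
        List.Lex (· < ·) (labelWord lam r a) (labelWord lam r c)

/-- A finite poset is CL-shellable (chain-lexicographically shellable) if it is graded and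
admits a CL-labeling with labels in some poset. -/
def IsCLShellable (P : Type*) [PartialOrder P] : Prop :=
  IsGradedPoset P ∧
    ∃ bot : P, IsBot bot ∧
      ∃ (L : Type) (_ : PartialOrder L) (lam : List P → L), IsCLLabeling bot lam

section OrderComplex

variable (K : Type*) [CommRing K] (Q : Type*) [PartialOrder Q]

/-- Simplicial chains of the order complex of `Q`, indexed by the number `k` of vertices:
the free module on the chains `q₁ < ⋯ < qₖ` of `Q`, i.e. on the simplices of dimension
`k - 1`. The empty simplex (`k = 0`) is included, so homology will be reduced. -/
abbrev OrderChains (k : ℕ) : Type _ := (Fin k ↪o Q) →₀ K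

/-- The simplicial boundary, the alternating sum of the faces. For `k = 0` this is the
augmentation. -/
noncomputable def orderBoundary (k : ℕ) : OrderChains K Q (k + 1) →ₗ[K] OrderChains K Q k :=
  Finsupp.linearCombination K fun f : Fin (k + 1) ↪o Q =>
    ∑ j : Fin (k + 1),
      Finsupp.single ((Fin.succAboveOrderEmb j).trans f) ((-1 : K) ^ (j : ℕ))

/-- The boundary of a boundary is zero. -/
theorem orderBoundary_orderBoundary (k : ℕ) (z : OrderChains K Q (k + 2)) :
    orderBoundary K Q k (orderBoundary K Q (k + 1) z) = 0 := by
  induction z using Finsupp.induction_linear with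
  | zero => simp
  | add x y hx hy => simp [hx, hy]
  | single f a =>
    simp only [orderBoundary, Finsupp.linearCombination_single, map_sum,
      Finset.smul_sum, Finsupp.smul_single, smul_eq_mul]
    rw [← Finset.sum_product']
    refine Finset.sum_involution (fun p _ => (p.1.succAbove p.2, p.2.predAbove p.1)) ?_ ?_ ?_ ?_
    · rintro ⟨i, j⟩ -
      have hf : (Fin.succAboveOrderEmb (j.predAbove i)).trans
          ((Fin.succAboveOrderEmb (i.succAbove j)).trans f) =
          (Fin.succAboveOrderEmb j).trans ((Fin.succAboveOrderEmb i).trans f) := by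
        ext l
        exact congrArg f (Fin.succAbove_succAbove_succAbove_predAbove i j l)
      have hs := Fin.neg_one_pow_succAbove_add_predAbove (R := K) i j
      rw [pow_add, pow_add] at hs
      simp only [hf, ← Finsupp.single_add]
      rw [mul_assoc, mul_assoc, hs, mul_neg, add_neg_cancel, Finsupp.single_zero]
    · rintro ⟨i, j⟩ - - h
      exact Fin.succAbove_ne i j (congrArg Prod.fst h)
    · simp
    · rintro ⟨i, j⟩ -
      simp [Fin.succAbove_succAbove_predAbove, Fin.predAbove_predAbove_succAbove]

/-- Cycles; every chain with no vertex is a cycle. -/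
noncomputable def orderCycles : (k : ℕ) → Submodule K (OrderChains K Q k)
  | 0 => ⊤
  | k + 1 => LinearMap.ker (orderBoundary K Q k)

/-- The reduced simplicial homology, with coefficients in `K`, of the order complex of `Q`
vanishes in dimension `k - 1`: every cycle is a boundary. -/
def ReducedHomologyVanishes (k : ℕ) : Prop :=
  orderCycles K Q k ≤ LinearMap.range (orderBoundary K Q k)

end OrderComplex

/-- A finite graded poset is Cohen-Macaulay over `K` if for all `x < y` the reduced homology of
(the order complex of) the open interval `(x, y)` vanishes except in its top dimension. If
the maximal chains of `[x, y]` have `m` edges, then this top dimension is `m - 2`, i.e. the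
largest chains of `(x, y)` have `k = m - 1` elements. -/
def IsCohenMacaulayPoset (K : Type*) [CommRing K] (P : Type*) [PartialOrder P] : Prop :=
  IsGradedPoset P ∧
    ∀ (x y : P) (c : List P), x < y → IsSaturatedChain x c y →
      ∀ k : ℕ, k + 1 ≠ c.length → ReducedHomologyVanishes K (Set.Ioo x y) k

/-! ### Multi-pointed partitions -/

/-- A multi-pointed partition of the `n`-element set `Fin n`: a partition with a non-empty
subset of each block. The pointed subsets are recorded by their union `pointed`; the pointed
subset of the block `B` is `B ∩ pointed`. -/
@[ext]
structure MultiPointedPartition (n : ℕ) where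
  blocks : Finpartition (Finset.univ : Finset (Fin n))
  pointed : Finset (Fin n)
  pointed_nonempty : ∀ B ∈ blocks.parts, (B ∩ pointed).Nonempty

namespace MultiPointedPartition

variable {n : ℕ}

/-- `ν` is obtained from `π` by gathering two blocks `A` and `B`; the pointed subset of
`A ∪ B` is the pointed subset of `A`, that of `B`, or their union; the other blocks keep
their pointed subsets. -/
def Gather (π ν : MultiPointedPartition n) : Prop :=
  ∃ A ∈ π.blocks.parts, ∃ B ∈ π.blocks.parts, A ≠ B ∧
    ν.blocks.parts = insert (A ∪ B) ((π.blocks.parts.erase A).erase B) ∧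
    ((A ∪ B) ∩ ν.pointed = A ∩ π.pointed ∨
      (A ∪ B) ∩ ν.pointed = B ∩ π.pointed ∨
      (A ∪ B) ∩ ν.pointed = (A ∩ π.pointed) ∪ (B ∩ π.pointed)) ∧
    ∀ C ∈ π.blocks.parts, C ≠ A → C ≠ B → C ∩ ν.pointed = C ∩ π.pointed

theorem Gather.card_lt {π ν : MultiPointedPartition n} (h : Gather π ν) :
    ν.blocks.parts.card < π.blocks.parts.card := by
  obtain ⟨A, hA, B, hB, hAB, hν, -⟩ := h
  have h1 := Finset.card_erase_add_one hA
  have h2 := Finset.card_erase_add_one (Finset.mem_erase.2 ⟨hAB.symm, hB⟩)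
  have h3 := Finset.card_insert_le (A ∪ B) ((π.blocks.parts.erase A).erase B)
  rw [hν]
  omega

theorem eq_or_card_lt_of_gathers {π ν : MultiPointedPartition n}
    (h : Relation.ReflTransGen Gather π ν) :
    π = ν ∨ ν.blocks.parts.card < π.blocks.parts.card := by
  induction h with
  | refl => exact Or.inl rfl
  | tail _ hg ih =>
    refine Or.inr ?_
    rcases ih with rfl | ih
    · exact hg.card_lt
    · exact hg.card_lt.trans ih

/-- The order of multi-pointed partitions: `π ≤ ν` if `ν` is obtained from `π` by
successively gathering pairs of blocks. -/
instance : PartialOrder (MultiPointedPartition n) where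
  le := Relation.ReflTransGen Gather
  le_refl _ := Relation.ReflTransGen.refl
  le_trans _ _ _ := Relation.ReflTransGen.trans
  le_antisymm π ν h h' := by
    rcases eq_or_card_lt_of_gathers h with e | e
    · exact e
    · rcases eq_or_card_lt_of_gathers h' with e' | e'
      · exact e'.symm
      · omega

/-- The least multi-pointed partition: all blocks are singletons, and all
elements are pointed. -/
def zero (n : ℕ) : MultiPointedPartition n where
  blocks := ⊥
  pointed := Finset.univ
  pointed_nonempty B hB := by
    rw [Finset.inter_univ]
    exact Finpartition.nonempty_of_mem_parts _ hB

/-- The interval between the least multi-pointed partition and `V`. -/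
abbrev IntervalBelow (V : MultiPointedPartition n) : Type := Set.Icc (zero n) V

end MultiPointedPartition

/-!
Everything follows from one property of the poset of multi-pointed partitions
(`MultiPointedPartition.isIntervalSemimodular`): two distinct covers `u`, `v` of `t` that lie below
`y` have a common cover below `y`. It passes to closed intervals, and gives total
semi-modularity at once.

To prove it, the order is first described without gatherings (`le_iff_refines`): `π ≤ ν` if and only
if every block of `π` lies in a block of `ν`, which keeps either all or none of its pointed
elements. If `u` and `v` arise from two disjoint pairs of blocks of `t`, both gatherings can be
performed. If the two pairs share the block `A`, say they are `A, B` and `A, C`, the common cover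
has the block `A ∪ B ∪ C`. Its pointed subset is dictated by `y` when `y` keeps a pointed element of
this block. Otherwise it is the pointed subset of `A ∪ B` in `u` if this avoids `A`, or that
of `A ∪ C` in `v` if this avoids `A`, or else the union of the two. If the two pairs
coincide, `y` must drop both blocks, and a third block that `y` keeps is gathered with them.

CL-shellability (`isCLLabeling_chainLabel`) is the theorem of Björner and Wachs that in a totally
semi-modular poset every ordering of the atoms is a recursive atom ordering. The labels along a
chain `⋯ ⋖ x ⋖ a ⋖ z` are defined recursively so that there is a descent at `a` exactly when `z` lies
above a cover of `x` with a smaller label than `a`. The chain which always moves to the atom with the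
least label is then increasing and lexicographically first; by semi-modularity, a chain that does not
begin with the least atom of `[x, y]` cannot be increasing.

The Cohen-Macaulay property is derived directly from semi-modularity, over any commutative
ring (`homologyVanishesOn_upTo`). The open interval `(x, y)` is the union of the `[a, y)` for
the atoms `a` of `[x, y]`; each of them is a cone, and the intersection of one with the union of others
is a union of the same kind for the interval `[a, y]`, so that Mayer-Vietoris and induction on
the length apply.
-/

/-! ### Saturated chains -/

/-- Upper semi-modularity of every closed interval, stated inside the ambient poset: two distinct
covers of `t` lying below `y` have a common cover below `y`. -/
def IsIntervalSemimodular (P : Type*) [PartialOrder P] : Prop :=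
  ∀ t u v y : P, t ⋖ u → t ⋖ v → u ≠ v → u ≤ y → v ≤ y → ∃ z : P, u ⋖ z ∧ v ⋖ z ∧ z ≤ y

section SaturatedChains

variable {P : Type*} [PartialOrder P]

theorem isSaturatedChain_nil {x y : P} : IsSaturatedChain x [] y ↔ x = y := by
  simp [IsSaturatedChain]

theorem isSaturatedChain_cons {x a y : P} {c : List P} :
    IsSaturatedChain x (a :: c) y ↔ x ⋖ a ∧ IsSaturatedChain a c y := by
  simp [IsSaturatedChain, and_assoc]

theorem IsSaturatedChain.le {x y : P} {c : List P} (h : IsSaturatedChain x c y) : x ≤ y := by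
  induction c generalizing x with
  | nil => exact (isSaturatedChain_nil.1 h).le
  | cons a c ih =>
    rw [isSaturatedChain_cons] at h
    exact h.1.le.trans (ih h.2)

theorem IsSaturatedChain.concat {x y z : P} {c : List P} (h : IsSaturatedChain x c y)
    (hz : y ⋖ z) : IsSaturatedChain x (c ++ [z]) z := by
  induction c generalizing x with
  | nil =>
    obtain rfl := isSaturatedChain_nil.1 h
    exact isSaturatedChain_cons.2 ⟨hz, isSaturatedChain_nil.2 rfl⟩
  | cons a c ih =>
    rw [isSaturatedChain_cons] at h
    exact isSaturatedChain_cons.2 ⟨h.1, ih h.2⟩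

theorem IsSaturatedChain.headD_reverse {x y : P} {c : List P} (h : IsSaturatedChain x c y) :
    c.reverse.headD x = y := by
  rcases List.eq_nil_or_concat c with rfl | ⟨d, a, rfl⟩
  · exact isSaturatedChain_nil.1 h
  · have := h.2
    simpa using this

theorem exists_isSaturatedChain [Finite P] {x y : P} (h : x ≤ y) :
    ∃ c, IsSaturatedChain x c y := by
  induction x using WellFoundedGT.induction with
  | ind x ih =>
    rcases h.eq_or_lt with rfl | h
    · exact ⟨[], isSaturatedChain_nil.2 rfl⟩
    · obtain ⟨a, hxa, hay⟩ := exists_covBy_le_of_lt h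
      obtain ⟨c, hc⟩ := ih a hxa.lt hay
      exact ⟨a :: c, isSaturatedChain_cons.2 ⟨hxa, hc⟩⟩

theorem IsSaturatedChain.rank_eq {ρ : P → ℕ} (hρ : ∀ a b, a ⋖ b → ρ b = ρ a + 1) {x y : P}
    {c : List P} (h : IsSaturatedChain x c y) : ρ y = ρ x + c.length := by
  induction c generalizing x with
  | nil => simp [isSaturatedChain_nil.1 h]
  | cons a c ih =>
    rw [isSaturatedChain_cons] at h
    rw [ih h.2, hρ _ _ h.1, List.length_cons]
    omega

theorem isPurePoset_of_rank {ρ : P → ℕ} (hρ : ∀ a b, a ⋖ b → ρ b = ρ a + 1) : IsPurePoset P := by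
  intro x y c c' h h'
  have := h.rank_eq hρ
  have := h'.rank_eq hρ
  omega

theorem coe_covBy_coe_Icc {a b : P} {u v : Set.Icc a b} : (u : P) ⋖ v ↔ u ⋖ v :=
  Set.OrdConnected.apply_covBy_apply_iff (OrderEmbedding.subtype (· ∈ Set.Icc a b)) (by
    rw [OrderEmbedding.coe_subtype, Subtype.range_coe]
    exact Set.ordConnected_Icc)

theorem isBoundedPoset_Icc {a b : P} (h : a ≤ b) : IsBoundedPoset (Set.Icc a b) :=
  ⟨⟨⟨a, le_rfl, h⟩, fun u => u.2.1⟩, ⟨⟨b, h, le_rfl⟩, fun u => u.2.2⟩⟩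

theorem IsIntervalSemimodular.icc (h : IsIntervalSemimodular P) (a b : P) :
    IsIntervalSemimodular (Set.Icc a b) := by
  intro t u v y htu htv huv huy hvy
  obtain ⟨z, huz, hvz, hzy⟩ := h t u v y (coe_covBy_coe_Icc.2 htu) (coe_covBy_coe_Icc.2 htv)
    (Subtype.coe_ne_coe.2 huv) huy hvy
  exact ⟨⟨z, u.2.1.trans huz.le, hzy.trans y.2.2⟩, coe_covBy_coe_Icc.1 huz,
    coe_covBy_coe_Icc.1 hvz, hzy⟩

theorem IsIntervalSemimodular.isTotallySemimodularPoset (h : IsIntervalSemimodular P)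
    (hP : IsBoundedPoset P) : IsTotallySemimodularPoset P := by
  refine ⟨hP, fun x y hxy => ⟨isBoundedPoset_Icc hxy, fun t u v htu htv huv => ?_⟩⟩
  obtain ⟨z, huz, hvz, -⟩ := h.icc x y t u v ⟨y, hxy, le_rfl⟩ htu htv huv u.2.2 v.2.2
  exact ⟨z, huz, hvz⟩

end SaturatedChains

/-! ### CL-shellability of totally semi-modular posets -/

section Labeling

variable {P : Type*} [PartialOrder P]

open Classical in
/-- The label of the edge leading to `y` in a chain which, above `bot`, consists of the reverse of
the given list followed by `y`. The labels around the preceding edge, leading to `x`, order the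
covers of the element before `x`; the label of `y` is below that of `x` if `y` lies
above a cover that comes before `x` in this order, and above that of `x` otherwise. The numbers
`e y`, assumed to be pairwise distinct and strictly between `0` and `N`, keep the labels of the
covers of `x` apart. -/
noncomputable def atomLabel (bot : P) (e : P → ℤ) (N : ℤ) : List P → P → ℤ
  | [], y => e y
  | x :: r, y => atomLabel bot e N r x +
      if ∃ b, r.headD bot ⋖ b ∧ atomLabel bot e N r b < atomLabel bot e N r x ∧ b < y then
        e y - N
      else e y

/-- The chain-edge labeling given by `atomLabel`, reading chains upwards. -/
noncomputable def chainLabel (bot : P) (e : P → ℤ) (N : ℤ) (l : List P) : ℤ :=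
  match l.reverse with
  | [] => 0
  | y :: r => atomLabel bot e N r y

variable {bot : P} {e : P → ℤ} {N : ℤ}

theorem chainLabel_concat (r : List P) (y : P) :
    chainLabel bot e N (r ++ [y]) = atomLabel bot e N r.reverse y := by
  simp [chainLabel]

theorem atomLabel_injective (he : Function.Injective e) (hpos : ∀ y, 0 < e y)
    (hlt : ∀ y, e y < N) (r : List P) : Function.Injective (atomLabel bot e N r) := by
  intro y z h
  have := hpos y
  have := hpos z
  have := hlt y
  have := hlt z
  cases r with
  | nil => exact he h
  | cons x r =>
    simp only [atomLabel] at h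
    apply he
    split_ifs at h <;> omega

/-- A descent of the labeling: the edge to `z` following the edge `x ⋖ a` has a smaller label
if `z` lies above a cover of `x` with a smaller label than `a`. -/
theorem chainLabel_lt (hlt : ∀ y, e y < N) {x a b z : P} {r : List P}
    (hr : IsSaturatedChain bot r x) (hb : x ⋖ b)
    (hba : chainLabel bot e N (r ++ [b]) < chainLabel bot e N (r ++ [a])) (hbz : b < z) :
    chainLabel bot e N (r ++ [a] ++ [z]) < chainLabel bot e N (r ++ [a]) := by
  rw [chainLabel_concat, chainLabel_concat] at hba ⊢
  have hlt' := hlt z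
  simp only [List.reverse_append, List.reverse_cons, List.reverse_nil, List.nil_append,
    List.singleton_append, atomLabel]
  rw [if_pos ⟨b, hr.headD_reverse.symm ▸ hb, hba, hbz⟩]
  omega

/-- An ascent of the labeling. -/
theorem chainLabel_le (hpos : ∀ y, 0 < e y) {x a z : P} {r : List P}
    (hr : IsSaturatedChain bot r x)
    (h : ∀ b, x ⋖ b → b < z →
      chainLabel bot e N (r ++ [a]) ≤ chainLabel bot e N (r ++ [b])) :
    chainLabel bot e N (r ++ [a]) ≤ chainLabel bot e N (r ++ [a] ++ [z]) := by
  simp only [chainLabel_concat] at *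
  have := hpos z
  simp only [List.reverse_append, List.reverse_cons, List.reverse_nil, List.nil_append,
    List.singleton_append, atomLabel]
  rw [if_neg (fun ⟨b, hb, hba, hbz⟩ => (h b (hr.headD_reverse ▸ hb) hbz).not_gt hba)]
  omega

theorem le_of_lex_cons {i j : ℤ} {s t : List ℤ} (h : List.Lex (· < ·) (i :: s) (j :: t)) :
    i ≤ j := by
  cases h with
  | rel h => exact h.le
  | cons => exact le_rfl

theorem isCLLabeling_chainLabel [Finite P] (hP : IsIntervalSemimodular P)
    (he : Function.Injective e) (hpos : ∀ y, 0 < e y) (hlt : ∀ y, e y < N) :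
    IsCLLabeling bot (chainLabel bot e N) := by
  intro x
  induction x using WellFoundedGT.induction with
  | ind x ih =>
  intro y r hxy hr
  rcases hxy.eq_or_lt with rfl | hxy
  · refine ⟨[], isSaturatedChain_nil.2 rfl, by simp [labelWord], fun c hc hne => ?_⟩
    obtain ⟨a, d, rfl⟩ := List.exists_cons_of_ne_nil hne
    rw [isSaturatedChain_cons] at hc
    exact absurd (hc.1.lt.trans_le hc.2.le) (lt_irrefl _)
  -- The increasing chain begins with the atom of `[x, y]` that has the least label.
  obtain ⟨a, ⟨hxa, hay⟩, hmin⟩ := Set.exists_min_image {a | x ⋖ a ∧ a ≤ y}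
    (fun a => chainLabel bot e N (r ++ [a])) (Set.toFinite _) (exists_covBy_le_of_lt hxy)
  obtain ⟨c, hc, hinc, huniq⟩ := ih a hxa.lt y (r ++ [a]) hay (hr.concat hxa)
  refine ⟨a :: c, isSaturatedChain_cons.2 ⟨hxa, hc⟩, ?_, fun d hd hne => ?_⟩
  · cases c with
    | nil => simp [labelWord]
    | cons z c =>
      refine List.isChain_cons_cons.2 ⟨chainLabel_le hpos hr fun b hb hbz => ?_, hinc⟩
      exact hmin b ⟨hb, hbz.le.trans (isSaturatedChain_cons.1 hc).2.le⟩
  · cases d with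
    | nil => exact absurd (isSaturatedChain_nil.1 hd) hxy.ne
    | cons a' d =>
      rw [isSaturatedChain_cons] at hd
      by_cases haa : a' = a
      · subst haa
        obtain ⟨h1, h2⟩ := huniq d hd.2 fun h => hne (by rw [h])
        exact ⟨fun h => h1 (List.IsChain.tail h), List.Lex.cons h2⟩
      have hlt' : chainLabel bot e N (r ++ [a]) < chainLabel bot e N (r ++ [a']) := by
        refine lt_of_le_of_ne (hmin a' ⟨hd.1, hd.2.le⟩) fun h => haa ?_
        rw [chainLabel_concat, chainLabel_concat] at h
        exact (atomLabel_injective he hpos hlt _ h).symm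
      refine ⟨fun hincd => ?_, List.Lex.rel hlt'⟩
      -- The rest of an increasing chain through `a'` would be the lexicographically first one,
      -- and so begin with a label at most that of a common cover of `a` and `a'`.
      obtain ⟨z, haz, haz', hzy⟩ := hP x a a' y hxa hd.1 (Ne.symm haa) hay hd.2.le
      have hz := chainLabel_lt hlt hr hxa hlt' haz.lt
      obtain ⟨f, -, -, hf⟩ := ih a' hd.1.lt y (r ++ [a']) hd.2.le (hr.concat hd.1)
      have hdf : d = f := by
        by_contra hdf
        exact (hf d hd.2 hdf).1 (List.IsChain.tail hincd)
      subst hdf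
      cases d with
      | nil =>
        obtain rfl := isSaturatedChain_nil.1 hd.2
        exact hd.1.2 hxa.lt (lt_of_le_of_ne hay (Ne.symm haa))
      | cons w d =>
        have hw := (List.isChain_cons_cons.1 hincd).1
        obtain ⟨g, hg⟩ := exists_isSaturatedChain hzy
        by_cases hzw : z :: g = w :: d
        · obtain ⟨rfl, -⟩ := List.cons_eq_cons.1 hzw
          exact hz.not_ge hw
        · have := (hf _ (isSaturatedChain_cons.2 ⟨haz', hg⟩) hzw).2
          exact ((le_of_lex_cons this).trans_lt hz).not_ge hw

theorem IsIntervalSemimodular.isCLShellable [Finite P] (hP : IsIntervalSemimodular P)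
    (hgr : IsGradedPoset P) : IsCLShellable P := by
  obtain ⟨bot, hbot⟩ := hgr.1.1
  obtain ⟨n, ⟨f⟩⟩ := Finite.exists_equiv_fin P
  refine ⟨hgr, bot, hbot, ℤ, inferInstance,
    chainLabel bot (fun y => (f y : ℤ) + 1) (n + 1), isCLLabeling_chainLabel hP ?_ ?_ ?_⟩
  · intro y z h
    exact f.injective (Fin.ext (by simpa using h))
  · intro y
    positivity
  · intro y
    have := (f y).2
    omega

end Labeling

/-! ### Homology of the order complex on a subset -/

section Homology

variable {K : Type*} [CommRing K] {P : Type*} [PartialOrder P]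

/-- The simplicial chains of `P` supported on simplices with all vertices in `U`. -/
def chainsIn (K : Type*) [CommRing K] {P : Type*} [PartialOrder P] (U : Set P) (k : ℕ) :
    Submodule K (OrderChains K P k) :=
  Finsupp.supported K K {f | ∀ i, f i ∈ U}

/-- The reduced homology of the order complex of `U ⊆ P` vanishes in dimension `k - 1`, stated with
chains of `P` supported on `U`. -/
def HomologyVanishesOn (K : Type*) [CommRing K] {P : Type*} [PartialOrder P] (U : Set P)
    (k : ℕ) : Prop :=
  ∀ z ∈ chainsIn K U k, z ∈ orderCycles K P k →
    ∃ w ∈ chainsIn K U (k + 1), orderBoundary K P k w = z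

theorem chainsIn_eq_span (U : Set P) (k : ℕ) :
    chainsIn K U k =
      Submodule.span K ((fun f => Finsupp.single f 1) '' {f : Fin k ↪o P | ∀ i, f i ∈ U}) :=
  Finsupp.supported_eq_span_single K _

theorem single_mem_chainsIn {U : Set P} {k : ℕ} {f : Fin k ↪o P} (hf : ∀ i, f i ∈ U) (c : K) :
    Finsupp.single f c ∈ chainsIn K U k :=
  Finsupp.single_mem_supported K c hf

theorem chainsIn_mono {U V : Set P} (h : U ⊆ V) (k : ℕ) : chainsIn K U k ≤ chainsIn K V k :=
  Finsupp.supported_mono fun _ hf i => h (hf i)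

theorem chainsIn_inf (U V : Set P) (k : ℕ) :
    chainsIn K U k ⊓ chainsIn K V k = chainsIn K (U ∩ V) k := by
  rw [chainsIn, chainsIn, ← Finsupp.supported_inter]
  congr 1
  ext f
  simp [forall_and]

theorem orderBoundary_single {k : ℕ} (f : Fin (k + 1) ↪o P) :
    orderBoundary K P k (Finsupp.single f 1) = ∑ j : Fin (k + 1),
      Finsupp.single ((Fin.succAboveOrderEmb j).trans f) ((-1 : K) ^ (j : ℕ)) := by
  simp [orderBoundary]

theorem orderBoundary_mem_chainsIn {U : Set P} {k : ℕ} {z : OrderChains K P (k + 1)}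
    (hz : z ∈ chainsIn K U (k + 1)) : orderBoundary K P k z ∈ chainsIn K U k := by
  suffices chainsIn K U (k + 1) ≤ (chainsIn K U k).comap (orderBoundary K P k) from this hz
  rw [chainsIn_eq_span (k := k + 1), Submodule.span_le]
  rintro _ ⟨f, hf, rfl⟩
  simp only [Submodule.comap_coe, Set.mem_preimage, SetLike.mem_coe, orderBoundary_single]
  exact Submodule.sum_mem _ fun j _ => single_mem_chainsIn (f := (Fin.succAboveOrderEmb j).trans f)
    (fun _ => hf _) _

theorem orderBoundary_mem_orderCycles (k : ℕ) (z : OrderChains K P (k + 1)) :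
    orderBoundary K P k z ∈ orderCycles K P k := by
  cases k with
  | zero => exact Submodule.mem_top
  | succ k => exact orderBoundary_orderBoundary K P k z

theorem homologyVanishesOn_zero {U : Set P} (hU : U.Nonempty) : HomologyVanishesOn K U 0 := by
  obtain ⟨u, hu⟩ := hU
  intro z _ _
  let f : Fin 1 ↪o P := OrderEmbedding.ofStrictMono (fun _ => u) (Subsingleton.strictMono _)
  let o : Fin 0 ↪o P := (Fin.succAboveOrderEmb 0).trans f
  refine ⟨Finsupp.single f (z o), single_mem_chainsIn (fun _ => hu) _, ?_⟩
  have ho : ∀ g : Fin 0 ↪o P, g = o := fun g => by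
    ext i
    exact i.elim0
  rw [← mul_one (z o), ← smul_eq_mul, ← Finsupp.smul_single, map_smul, orderBoundary_single]
  ext g
  rw [ho g]
  simp [o]

/-- The chain `a < q₁ < ⋯ < qₖ`. -/
def consOrderEmb (a : P) {k : ℕ} (f : Fin k ↪o P) (h : ∀ i, a < f i) : Fin (k + 1) ↪o P :=
  OrderEmbedding.ofStrictMono (Fin.cons a f) (by
    intro i j hij
    induction j using Fin.cases with
    | zero => exact absurd hij (Fin.not_lt_zero i)
    | succ j =>
      induction i using Fin.cases with
      | zero => simpa using h j
      | succ i => simpa using hij)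

theorem consOrderEmb_zero (a : P) {k : ℕ} (f : Fin k ↪o P) (h : ∀ i, a < f i) :
    consOrderEmb a f h 0 = a := rfl

theorem consOrderEmb_succ (a : P) {k : ℕ} (f : Fin k ↪o P) (h : ∀ i, a < f i) (i : Fin k) :
    consOrderEmb a f h i.succ = f i := rfl

open Classical in
/-- The cone operator with apex `a`: it adds `a` to the simplices all of whose vertices are greater
than `a`, and kills the others. -/
noncomputable def coneOperator (K : Type*) [CommRing K] {P : Type*} [PartialOrder P] (a : P)
    (k : ℕ) : OrderChains K P k →ₗ[K] OrderChains K P (k + 1) :=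
  Finsupp.linearCombination K fun f =>
    if h : ∀ i, a < f i then Finsupp.single (consOrderEmb a f h) 1 else 0

theorem coneOperator_single_of_lt {a : P} {k : ℕ} {f : Fin k ↪o P} (h : ∀ i, a < f i) (c : K) :
    coneOperator K a k (Finsupp.single f c) = Finsupp.single (consOrderEmb a f h) c := by
  simp [coneOperator, h]

theorem coneOperator_single_of_eq {a : P} {k : ℕ} {f : Fin k ↪o P} {i : Fin k} (h : f i = a)
    (c : K) : coneOperator K a k (Finsupp.single f c) = 0 := by
  have : ¬ ∀ i, a < f i := fun h' => (h' i).ne' h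
  simp [coneOperator, this]

/-- The cone operator is a contracting homotopy on the chains supported above its apex. -/
theorem coneOperator_homotopy {a : P} {k : ℕ} {z : OrderChains K P (k + 1)}
    (hz : z ∈ chainsIn K (Set.Ici a) (k + 1)) :
    orderBoundary K P (k + 1) (coneOperator K a (k + 1) z) +
      coneOperator K a k (orderBoundary K P k z) = z := by
  suffices chainsIn K (Set.Ici a) (k + 1) ≤ LinearMap.eqLocus
      (orderBoundary K P (k + 1) ∘ₗ coneOperator K a (k + 1) +
        coneOperator K a k ∘ₗ orderBoundary K P k) LinearMap.id from this hz
  rw [chainsIn_eq_span, Submodule.span_le]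
  rintro _ ⟨f, hf, rfl⟩
  simp only [SetLike.mem_coe, LinearMap.mem_eqLocus, LinearMap.add_apply, LinearMap.comp_apply,
    LinearMap.id_apply]
  by_cases h0 : f 0 = a
  -- If `a` is a vertex of `f`, only the face opposite to `a` survives the cone operator.
  · rw [coneOperator_single_of_eq h0, map_zero, zero_add, orderBoundary_single, map_sum,
      Fin.sum_univ_succ, Finset.sum_eq_zero, add_zero]
    · have h : ∀ i, a < (Fin.succAboveOrderEmb 0).trans f i := fun i => by
        rw [← h0]
        exact f.strictMono (by simp)
      rw [coneOperator_single_of_lt h, Fin.val_zero, pow_zero]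
      congr 1
      ext i
      induction i using Fin.cases with
      | zero => simp [consOrderEmb_zero, h0]
      | succ i => simp [consOrderEmb_succ]
    · intro j _
      cases k with
      | zero => exact j.elim0
      | succ k =>
        refine coneOperator_single_of_eq (i := 0) ?_ _
        simpa using h0
  -- Otherwise the face of `a * f` opposite to `a` is `f`, and the other faces cancel with the
  -- cones over the faces of `f`.
  · have h : ∀ i, a < f i := fun i =>
      (lt_of_le_of_ne (hf 0) (Ne.symm h0)).trans_le (f.monotone (Fin.zero_le i))
    rw [coneOperator_single_of_lt h, orderBoundary_single, orderBoundary_single, map_sum,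
      Fin.sum_univ_succ, add_assoc, ← Finset.sum_add_distrib, Finset.sum_eq_zero, add_zero]
    · rw [Fin.val_zero, pow_zero]
      congr 1
    · intro j _
      rw [coneOperator_single_of_lt (f := (Fin.succAboveOrderEmb j).trans f) (fun i => h _),
        Fin.val_succ, pow_succ, mul_neg_one, Finsupp.single_neg, neg_add_eq_zero]
      congr 1
      ext i
      induction i using Fin.cases with
      | zero =>
        simp only [RelEmbedding.coe_trans, Function.comp_apply, Fin.succAboveOrderEmb_apply,
          Fin.succ_succAbove_zero, consOrderEmb_zero]
        rfl
      | succ i =>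
        simp only [RelEmbedding.coe_trans, Function.comp_apply, Fin.succAboveOrderEmb_apply,
          Fin.succ_succAbove_succ, consOrderEmb_succ]
        rfl

theorem coneOperator_mem_chainsIn {U : Set P} {a : P} (ha : a ∈ U) {k : ℕ}
    {z : OrderChains K P k} (hz : z ∈ chainsIn K U k) :
    coneOperator K a k z ∈ chainsIn K U (k + 1) := by
  suffices chainsIn K U k ≤ (chainsIn K U (k + 1)).comap (coneOperator K a k) from this hz
  rw [chainsIn_eq_span, Submodule.span_le]
  rintro _ ⟨f, hf, rfl⟩
  simp only [Submodule.comap_coe, Set.mem_preimage, SetLike.mem_coe]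
  by_cases h : ∀ i, a < f i
  · rw [coneOperator_single_of_lt h]
    refine single_mem_chainsIn (fun i => ?_) _
    induction i using Fin.cases with
    | zero => exact ha
    | succ i => exact hf i
  · simp [coneOperator, h]

theorem homologyVanishesOn_of_isLeast {U : Set P} {a : P} (ha : IsLeast U a) (k : ℕ) :
    HomologyVanishesOn K U k := by
  cases k with
  | zero => exact homologyVanishesOn_zero ⟨a, ha.1⟩
  | succ k =>
    intro z hz hz0
    refine ⟨coneOperator K a (k + 1) z, coneOperator_mem_chainsIn ha.1 hz, ?_⟩
    have h := coneOperator_homotopy (chainsIn_mono (fun u hu => ha.2 hu) _ hz)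
    rwa [show orderBoundary K P k z = 0 from hz0, map_zero, add_zero] at h

/-- The part of the Mayer-Vietoris sequence that bounds the homology of a union of two up-sets. -/
theorem HomologyVanishesOn.union {U V : Set P} {k : ℕ}
    (hU : HomologyVanishesOn K U (k + 1)) (hV : HomologyVanishesOn K V (k + 1))
    (hUV : HomologyVanishesOn K (U ∩ V) k)
    (hU' : ∀ u ∈ U, ∀ v ∈ U ∪ V, u ≤ v → v ∈ U)
    (hV' : ∀ u ∈ V, ∀ v ∈ U ∪ V, u ≤ v → v ∈ V) :
    HomologyVanishesOn K (U ∪ V) (k + 1) := by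
  intro z hz hz0
  -- A simplex lies in whichever of the two up-sets contains its least vertex.
  have hsup : chainsIn K (U ∪ V) (k + 1) = chainsIn K U (k + 1) ⊔ chainsIn K V (k + 1) := by
    rw [chainsIn, chainsIn, chainsIn, ← Finsupp.supported_union]
    congr 1
    ext f
    refine ⟨fun hf => ?_, ?_⟩
    · rcases hf 0 with h | h
      · exact Or.inl fun i => hU' _ h _ (hf i) (f.monotone (Fin.zero_le i))
      · exact Or.inr fun i => hV' _ h _ (hf i) (f.monotone (Fin.zero_le i))
    · rintro (h | h) i
      exacts [Or.inl (h i), Or.inr (h i)]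
  rw [hsup] at hz
  obtain ⟨z₁, h₁, z₂, h₂, rfl⟩ := Submodule.mem_sup.1 hz
  have h0 : orderBoundary K P k z₁ + orderBoundary K P k z₂ = 0 := by
    rw [← map_add]
    exact hz0
  obtain ⟨v, hv, hvz⟩ := hUV (orderBoundary K P k z₁) (by
      rw [← chainsIn_inf]
      refine ⟨orderBoundary_mem_chainsIn h₁, ?_⟩
      rw [eq_neg_of_add_eq_zero_left h0]
      exact neg_mem (orderBoundary_mem_chainsIn h₂)) (orderBoundary_mem_orderCycles k z₁)
  rw [← chainsIn_inf] at hv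
  obtain ⟨w₁, hw₁, e₁⟩ := hU (z₁ - v) (sub_mem h₁ hv.1) (by
    change orderBoundary K P k _ = 0
    rw [map_sub, hvz, sub_self])
  obtain ⟨w₂, hw₂, e₂⟩ := hV (z₂ + v) (add_mem h₂ hv.2) (by
    change orderBoundary K P k _ = 0
    rw [map_add, hvz, add_comm, h0])
  refine ⟨w₁ + w₂, add_mem (chainsIn_mono Set.subset_union_left _ hw₁)
    (chainsIn_mono Set.subset_union_right _ hw₂), ?_⟩
  rw [map_add, e₁, e₂]
  abel

theorem HomologyVanishesOn.reducedHomologyVanishes {U : Set P} {k : ℕ}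
    (h : HomologyVanishesOn K U k) : ReducedHomologyVanishes K U k := by
  let ι (k : ℕ) (f : Fin k ↪o U) : Fin k ↪o P := f.trans (OrderEmbedding.subtype _)
  have hι (k : ℕ) : Function.Injective (ι k) := fun f g hfg => by
    ext i
    exact congrArg (fun f => f i) hfg
  have hcomm (k : ℕ) (z : OrderChains K U (k + 1)) :
      orderBoundary K P k (Finsupp.lmapDomain K K (ι (k + 1)) z) =
        Finsupp.lmapDomain K K (ι k) (orderBoundary K U k z) := by
    induction z using Finsupp.induction_linear with
    | zero => simp
    | add x y hx hy => simp only [map_add, hx, hy]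
    | single f a =>
      rw [Finsupp.lmapDomain_apply, Finsupp.lmapDomain_apply, Finsupp.mapDomain_single]
      simp only [orderBoundary, Finsupp.linearCombination_single, Finsupp.mapDomain_smul]
      congr 1
      rw [← Finsupp.lmapDomain_apply K K, map_sum]
      refine Finset.sum_congr rfl fun j _ => ?_
      rw [Finsupp.lmapDomain_apply, Finsupp.mapDomain_single]
      rfl
  have hmem (k : ℕ) (z : OrderChains K U k) :
      Finsupp.lmapDomain K K (ι k) z ∈ chainsIn K U k := by
    induction z using Finsupp.induction_linear with
    | zero => simp
    | add x y hx hy => rw [map_add]; exact add_mem hx hy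
    | single f a =>
      rw [Finsupp.lmapDomain_apply, Finsupp.mapDomain_single]
      exact single_mem_chainsIn (fun i => (f i).2) _
  have hrange (k : ℕ) :
      chainsIn K U k ≤ LinearMap.range (Finsupp.lmapDomain K K (ι k)) := by
    rw [chainsIn_eq_span, Submodule.span_le]
    rintro _ ⟨f, hf, rfl⟩
    let g : Fin k ↪o U := OrderEmbedding.ofStrictMono (fun i => ⟨f i, hf i⟩)
      fun i j hij => f.strictMono hij
    exact ⟨Finsupp.single g 1, by
      rw [Finsupp.lmapDomain_apply, Finsupp.mapDomain_single]
      rfl⟩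
  intro z hz
  obtain ⟨w, hw, hwz⟩ := h (Finsupp.lmapDomain K K (ι k) z) (hmem k z) (by
    cases k with
    | zero => exact Submodule.mem_top
    | succ k =>
      change orderBoundary K P k _ = 0
      rw [hcomm, show orderBoundary K U k z = 0 from hz, map_zero])
  obtain ⟨w, rfl⟩ := hrange _ hw
  refine ⟨w, Finsupp.mapDomain_injective (hι k) ?_⟩
  rw [hcomm] at hwz
  exact hwz

/-! ### The Cohen-Macaulay property of totally semi-modular posets -/

/-- The union of the half-open intervals `[a, y)` for `a ∈ A`. -/
def upTo (A : Set P) (y : P) : Set P :=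
  {w | w < y ∧ ∃ a ∈ A, a ≤ w}

/-- Unions of intervals `[a, y)`, with `a` running through atoms of `[x, y]`, have
vanishing reduced homology below the top dimension. The intervals are added one by one. Each is
a cone, and by semi-modularity it meets the union of the previous ones in a union of intervals
`[z, y)` with `z` running through atoms of `[a, y]`. -/
theorem homologyVanishesOn_upTo [Finite P] (hP : IsIntervalSemimodular P) {ρ : P → ℕ}
    (hρ : ∀ a b, a ⋖ b → ρ b = ρ a + 1) (k : ℕ) (x y : P) (hk : ρ x + k + 1 < ρ y)
    (A : Set P) (hA : A.Nonempty) (hAx : ∀ a ∈ A, x ⋖ a ∧ a ≤ y) :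
    HomologyVanishesOn K (upTo A y) k := by
  induction k generalizing x A with
  | zero =>
    obtain ⟨a, ha⟩ := hA
    refine homologyVanishesOn_zero ⟨a, lt_of_le_of_ne (hAx a ha).2 ?_, a, ha, le_rfl⟩
    rintro rfl
    have := hρ _ _ (hAx a ha).1
    omega
  | succ k ih =>
    induction A, (Set.toFinite A) using Set.Finite.induction_on with
    | empty => exact absurd hA Set.not_nonempty_empty
    | @insert a A haA _ ihA =>
      obtain ⟨hxa, hay⟩ := hAx a (Set.mem_insert _ _)
      have hρa := hρ _ _ hxa
      have hay' : a < y := lt_of_le_of_ne hay (by rintro rfl; omega)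
      have hcone : HomologyVanishesOn K (Set.Ico a y) (k + 1) :=
        homologyVanishesOn_of_isLeast ⟨Set.left_mem_Ico.2 hay', fun u hu => hu.1⟩ _
      rcases A.eq_empty_or_nonempty with rfl | hne
      · convert hcone using 1
        ext w
        simp [upTo, and_comm]
      · have hAx' : ∀ b ∈ A, x ⋖ b ∧ b ≤ y := fun b hb => hAx b (Set.mem_insert_of_mem _ hb)
        have hinter : upTo A y ∩ Set.Ico a y =
            upTo {z | a ⋖ z ∧ z ≤ y ∧ ∃ b ∈ A, b ≤ z} y := by
          ext w
          constructor
          · rintro ⟨⟨hwy, b, hb, hbw⟩, haw, -⟩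
            obtain ⟨z, haz, hbz, hzw⟩ := hP x a b w hxa (hAx' b hb).1
              (by rintro rfl; exact haA hb) haw hbw
            exact ⟨hwy, z, ⟨haz, hzw.trans hwy.le, b, hb, hbz.le⟩, hzw⟩
          · rintro ⟨hwy, z, ⟨haz, -, b, hb, hbz⟩, hzw⟩
            exact ⟨⟨hwy, b, hb, hbz.trans hzw⟩, haz.le.trans hzw, hwy⟩
        have hunion : upTo (insert a A) y = upTo A y ∪ Set.Ico a y := by
          ext w
          simp only [upTo, Set.mem_insert_iff, Set.mem_ofPred_eq, Set.mem_union, Set.mem_Ico,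
            exists_eq_or_imp, and_or_left]
          rw [or_comm, @and_comm (a ≤ w)]
        rw [hunion]
        refine (ihA hne hAx').union hcone ?_ ?_ ?_
        · rw [hinter]
          refine ih a (by omega) _ ?_ fun z hz => And.intro hz.1 hz.2.1
          obtain ⟨b, hb⟩ := hne
          obtain ⟨z, haz, hbz, hzy⟩ := hP x a b y hxa (hAx' b hb).1
            (by rintro rfl; exact haA hb) hay (hAx' b hb).2
          exact ⟨z, haz, hzy, b, hb, hbz.le⟩
        · rintro u ⟨-, b, hb, hbu⟩ v hv huv
          exact ⟨hv.elim (fun h => h.1) (fun h => h.2), b, hb, hbu.trans huv⟩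
        · rintro u ⟨hau, -⟩ v hv huv
          exact ⟨hau.trans huv, hv.elim (fun h => h.1) (fun h => h.2)⟩

theorem IsIntervalSemimodular.isCohenMacaulayPoset [Finite P] (hP : IsIntervalSemimodular P)
    (hb : IsBoundedPoset P) {ρ : P → ℕ} (hρ : ∀ a b, a ⋖ b → ρ b = ρ a + 1)
    (hmono : StrictMono ρ) : IsCohenMacaulayPoset K P := by
  refine ⟨⟨hb, isPurePoset_of_rank hρ⟩, fun x y c hxy hc k hk => ?_⟩
  have hlen := hc.rank_eq hρ
  rcases lt_or_gt_of_ne hk with hk | hk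
  · apply HomologyVanishesOn.reducedHomologyVanishes
    have : Set.Ioo x y = upTo {a | x ⋖ a ∧ a ≤ y} y := by
      ext w
      constructor
      · rintro ⟨hxw, hwy⟩
        obtain ⟨a, hxa, haw⟩ := exists_covBy_le_of_lt hxw
        exact ⟨hwy, a, ⟨hxa, haw.trans hwy.le⟩, haw⟩
      · rintro ⟨hwy, a, ⟨hxa, hay⟩, haw⟩
        exact ⟨hxa.lt.trans_le haw, hwy⟩
    rw [this]
    exact homologyVanishesOn_upTo hP hρ k x y (by omega) _ (exists_covBy_le_of_lt hxy)
      fun _ ha => ha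
  · -- There are no simplices above the top dimension.
    have hempty : IsEmpty (Fin k ↪o Set.Ioo x y) := by
      refine ⟨fun f => ?_⟩
      have hcard := Fintype.card_le_of_injective
        (fun i : Fin k => (⟨ρ (f i), Finset.mem_Ioo.2 ⟨hmono (f i).2.1, hmono (f i).2.2⟩⟩ :
          Finset.Ioo (ρ x) (ρ y)))
        (StrictMono.injective fun i j hij => hmono (f.strictMono hij))
      rw [Fintype.card_fin, Fintype.card_coe, Nat.card_Ioo] at hcard
      have := hmono hxy
      omega
    intro z _
    rw [Subsingleton.elim z 0]
    exact zero_mem _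

end Homology

/-! ### The order of multi-pointed partitions -/

namespace MultiPointedPartition

variable {n : ℕ} {π ν ρ : MultiPointedPartition n}

/-- On the set `B`, the set `S` is either empty or equal to `T`. -/
def Inherits (B S T : Finset (Fin n)) : Prop :=
  (∀ e ∈ B, e ∉ S) ∨ ∀ e ∈ B, (e ∈ S ↔ e ∈ T)

/-- A description of the order without reference to gatherings: every block of `π` lies in a
block of `ν`, and its pointed elements are all kept or all dropped in `ν`. -/
def Refines (π ν : MultiPointedPartition n) : Prop :=
  (∀ B ∈ π.blocks.parts, ∃ C ∈ ν.blocks.parts, B ⊆ C) ∧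
    ∀ B ∈ π.blocks.parts, Inherits B ν.pointed π.pointed

theorem notMem_of_ne {A B : Finset (Fin n)} (hA : A ∈ π.blocks.parts) (hB : B ∈ π.blocks.parts)
    (hAB : A ≠ B) {e : Fin n} (he : e ∈ A) : e ∉ B :=
  fun he' => hAB (π.blocks.eq_of_mem_parts hA hB he he')

theorem exists_mem_pointed {B : Finset (Fin n)} (hB : B ∈ π.blocks.parts) :
    ∃ e ∈ B, e ∈ π.pointed := by
  obtain ⟨e, he⟩ := π.pointed_nonempty B hB
  exact ⟨e, Finset.mem_inter.1 he⟩

theorem exists_block (π : MultiPointedPartition n) (e : Fin n) : ∃ B ∈ π.blocks.parts, e ∈ B :=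
  π.blocks.exists_mem (Finset.mem_univ e)

/-- If two sets that meet lie in blocks of `ν`, these blocks coincide. -/
theorem subset_of_subset {A B C D : Finset (Fin n)} (hC : C ∈ ν.blocks.parts)
    (hD : D ∈ ν.blocks.parts) (hA : A ⊆ C) (hB : B ⊆ D) {e : Fin n} (heA : e ∈ A) (heB : e ∈ B) :
    B ⊆ C := by
  rwa [ν.blocks.eq_of_mem_parts hC hD (hA heA) (hB heB)]

theorem Refines.refl (π : MultiPointedPartition n) : Refines π π :=
  ⟨fun B hB => ⟨B, hB, subset_rfl⟩, fun _ _ => Or.inr fun _ _ => Iff.rfl⟩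

theorem Refines.trans (h : Refines π ν) (h' : Refines ν ρ) : Refines π ρ := by
  refine ⟨fun B hB => ?_, fun B hB => ?_⟩
  · obtain ⟨C, hC, hBC⟩ := h.1 B hB
    obtain ⟨D, hD, hCD⟩ := h'.1 C hC
    exact ⟨D, hD, hBC.trans hCD⟩
  · obtain ⟨C, hC, hBC⟩ := h.1 B hB
    rcases h'.2 C hC with h1 | h1
    · exact Or.inl fun e he => h1 e (hBC he)
    · rcases h.2 B hB with h2 | h2
      · exact Or.inl fun e he => (h1 e (hBC he)).not.2 (h2 e he)
      · exact Or.inr fun e he => (h1 e (hBC he)).trans (h2 e he)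

/-- A block that survives keeps its pointed elements. -/
theorem Refines.mem_pointed_iff (h : Refines π ν) {B : Finset (Fin n)} (hB : B ∈ π.blocks.parts)
    (hB' : B ∈ ν.blocks.parts) {e : Fin n} (he : e ∈ B) : e ∈ ν.pointed ↔ e ∈ π.pointed := by
  rcases h.2 B hB with h | h
  · obtain ⟨f, hf, hf'⟩ := exists_mem_pointed hB'
    exact absurd hf' (h f hf)
  · exact h e he

theorem gather_iff : Gather π ν ↔ ∃ A ∈ π.blocks.parts, ∃ B ∈ π.blocks.parts, A ≠ B ∧
    ν.blocks.parts = insert (A ∪ B) ((π.blocks.parts.erase A).erase B) ∧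
    ∀ E ∈ π.blocks.parts, Inherits E ν.pointed π.pointed := by
  constructor
  · rintro ⟨A, hA, B, hB, hAB, hν, hS, hE⟩
    have hdisj : ∀ e ∈ A, e ∉ B := fun e he => notMem_of_ne hA hB hAB he
    refine ⟨A, hA, B, hB, hAB, hν, fun E hEπ => ?_⟩
    simp only [Finset.ext_iff, Finset.mem_inter, Finset.mem_union] at hS
    by_cases hEA : E = A
    · subst hEA
      rcases hS with hS | hS | hS
      · right; grind
      · left; grind
      · right; grind
    by_cases hEB : E = B
    · subst hEB
      rcases hS with hS | hS | hS
      · left; grind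
      · right; grind
      · right; grind
    have := hE E hEπ hEA hEB
    simp only [Finset.ext_iff, Finset.mem_inter] at this
    right; grind
  · rintro ⟨A, hA, B, hB, hAB, hν, hE⟩
    refine ⟨A, hA, B, hB, hAB, hν, ?_, fun C hC hCA hCB => ?_⟩
    · obtain ⟨f, hf, hf'⟩ := exists_mem_pointed (π := ν) (B := A ∪ B) (by simp [hν])
      rw [Finset.mem_union] at hf
      simp only [Finset.ext_iff, Finset.mem_inter, Finset.mem_union]
      rcases hE A hA with hA' | hA' <;> rcases hE B hB with hB' | hB'
      · grind
      · right; left; grind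
      · left; grind
      · right; right; grind
    · obtain ⟨f, hf, hf'⟩ := exists_mem_pointed (π := ν) (B := C) (by simp [hν, hC, hCA, hCB])
      simp only [Finset.ext_iff, Finset.mem_inter]
      rcases hE C hC with hC' | hC' <;> grind

theorem Gather.refines (h : Gather π ν) : Refines π ν := by
  obtain ⟨A, hA, B, hB, hAB, hν, hE⟩ := gather_iff.1 h
  refine ⟨fun C hC => ?_, hE⟩
  by_cases hCA : C = A
  · exact ⟨A ∪ B, by simp [hν], hCA ▸ Finset.subset_union_left⟩
  by_cases hCB : C = B
  · exact ⟨A ∪ B, by simp [hν], hCB ▸ Finset.subset_union_right⟩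
  exact ⟨C, by simp [hν, hC, hCA, hCB], subset_rfl⟩

theorem union_notMem {A B : Finset (Fin n)} (hA : A ∈ π.blocks.parts) (hB : B ∈ π.blocks.parts)
    (hAB : A ≠ B) : A ∪ B ∉ π.blocks.parts := by
  intro h
  obtain ⟨e, he, -⟩ := exists_mem_pointed hA
  obtain ⟨f, hf, -⟩ := exists_mem_pointed hB
  apply hAB
  rw [π.blocks.eq_of_mem_parts hA h he (Finset.mem_union_left _ he)]
  exact π.blocks.eq_of_mem_parts h hB (Finset.mem_union_right _ hf) hf

theorem Gather.card_eq (h : Gather π ν) :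
    π.blocks.parts.card = ν.blocks.parts.card + 1 := by
  obtain ⟨A, hA, B, hB, hAB, hν, -⟩ := h
  have h1 := Finset.card_erase_add_one hA
  have h2 := Finset.card_erase_add_one (Finset.mem_erase.2 ⟨hAB.symm, hB⟩)
  have h3 : A ∪ B ∉ (π.blocks.parts.erase A).erase B := fun h =>
    union_notMem hA hB hAB (Finset.mem_of_mem_erase (Finset.mem_of_mem_erase h))
  rw [hν, Finset.card_insert_of_notMem h3]
  omega

theorem card_lt_of_lt (h : π < ν) : ν.blocks.parts.card < π.blocks.parts.card :=
  (eq_or_card_lt_of_gathers h.le).resolve_left h.ne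

theorem covBy_iff_gather : π ⋖ ν ↔ Gather π ν := by
  constructor
  · intro h
    rcases Relation.ReflTransGen.cases_head h.le with e | ⟨σ, hσ, hσν⟩
    · exact absurd e h.ne
    · have h1 : π < σ := lt_of_le_of_ne (Relation.ReflTransGen.single hσ) fun e =>
        absurd hσ.card_lt (by rw [e]; exact lt_irrefl _)
      have h2 : σ ≤ ν := hσν
      rcases h2.eq_or_lt with rfl | h2
      · exact hσ
      · exact absurd h2 (h.2 h1)
  · intro h
    refine ⟨lt_of_le_of_ne (Relation.ReflTransGen.single h) fun e =>
      absurd h.card_lt (by rw [e]; exact lt_irrefl _), fun σ h1 h2 => ?_⟩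
    have := card_lt_of_lt h1
    have := card_lt_of_lt h2
    have := h.card_eq
    omega

/-- The multi-pointed partition obtained by gathering the blocks `A` and `B` of `π` into a block
with pointed subset `S`. -/
def merge (π : MultiPointedPartition n) {A B S : Finset (Fin n)} (hA : A ∈ π.blocks.parts)
    (hB : B ∈ π.blocks.parts) (hS : S.Nonempty) (hSAB : S ⊆ A ∪ B) :
    MultiPointedPartition n where
  blocks := Finpartition.ofExistsUnique
    (insert (A ∪ B) ((π.blocks.parts.erase A).erase B))
    (fun _ _ => Finset.subset_univ _)
    (fun e _ => by
      obtain ⟨C, hC, heC⟩ := π.exists_block e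
      by_cases he : e ∈ A ∪ B
      · refine ⟨A ∪ B, ⟨by simp, he⟩, ?_⟩
        rintro D ⟨hD, heD⟩
        simp only [Finset.mem_insert, Finset.mem_erase] at hD
        rcases hD with rfl | ⟨hDB, hDA, hD⟩
        · rfl
        · rcases Finset.mem_union.1 he with he | he
          · exact absurd heD (notMem_of_ne hA hD (Ne.symm hDA) he)
          · exact absurd heD (notMem_of_ne hB hD (Ne.symm hDB) he)
      · refine ⟨C, ⟨?_, heC⟩, ?_⟩
        · simp only [Finset.mem_insert, Finset.mem_erase]
          refine Or.inr ⟨?_, ?_, hC⟩ <;> rintro rfl <;> simp [heC] at he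
        · rintro D ⟨hD, heD⟩
          simp only [Finset.mem_insert, Finset.mem_erase] at hD
          rcases hD with rfl | ⟨-, -, hD⟩
          · exact absurd heD he
          · exact π.blocks.eq_of_mem_parts hD hC heD heC)
    (by
      simp only [Finset.mem_insert, Finset.mem_erase, not_or, not_and]
      refine ⟨fun h => ?_, fun _ _ h => π.blocks.bot_notMem h⟩
      rw [← h, Finset.subset_empty] at hSAB
      exact hS.ne_empty hSAB)
  pointed := (π.pointed \ (A ∪ B)) ∪ S
  pointed_nonempty C hC := by
    simp only [Finpartition.ofExistsUnique, Finset.mem_insert, Finset.mem_erase] at hC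
    rcases hC with rfl | ⟨hCB, hCA, hC⟩
    · obtain ⟨e, he⟩ := hS
      exact ⟨e, by simp [he, Finset.mem_union.1 (hSAB he)]⟩
    · obtain ⟨e, he, he'⟩ := exists_mem_pointed hC
      exact ⟨e, by simp [he, he', notMem_of_ne hC hA hCA he, notMem_of_ne hC hB hCB he]⟩

section Merge

variable {A B S : Finset (Fin n)} {hA : A ∈ π.blocks.parts} {hB : B ∈ π.blocks.parts}
  {hS : S.Nonempty} {hSAB : S ⊆ A ∪ B}

theorem merge_parts : (π.merge hA hB hS hSAB).blocks.parts =
    insert (A ∪ B) ((π.blocks.parts.erase A).erase B) := rfl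

theorem mem_merge_pointed_of_mem {e : Fin n} (he : e ∈ A ∪ B) :
    e ∈ (π.merge hA hB hS hSAB).pointed ↔ e ∈ S := by
  simp only [merge, Finset.mem_union, Finset.mem_sdiff] at he ⊢
  tauto

theorem mem_merge_pointed_of_notMem {e : Fin n} (he : e ∉ A ∪ B) :
    e ∈ (π.merge hA hB hS hSAB).pointed ↔ e ∈ π.pointed := by
  have : e ∉ S := fun h => he (hSAB h)
  simp only [merge, Finset.mem_union, Finset.mem_sdiff] at he ⊢
  tauto

theorem notMem_union_of_ne {C : Finset (Fin n)} (hA : A ∈ π.blocks.parts)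
    (hB : B ∈ π.blocks.parts) (hC : C ∈ π.blocks.parts) (hCA : C ≠ A) (hCB : C ≠ B)
    {e : Fin n} (he : e ∈ C) : e ∉ A ∪ B := by
  simp [notMem_of_ne hC hA hCA he, notMem_of_ne hC hB hCB he]

theorem gather_merge (hAB : A ≠ B) (hSA : Inherits A S π.pointed) (hSB : Inherits B S π.pointed) :
    Gather π (π.merge hA hB hS hSAB) := by
  refine gather_iff.2 ⟨A, hA, B, hB, hAB, merge_parts, fun E hE => ?_⟩
  by_cases hEA : E = A
  · subst hEA
    exact hSA.imp (fun h e he => by simpa [mem_merge_pointed_of_mem, he] using h e he)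
      fun h e he => by simpa [mem_merge_pointed_of_mem, he] using h e he
  by_cases hEB : E = B
  · subst hEB
    exact hSB.imp (fun h e he => by simpa [mem_merge_pointed_of_mem, he] using h e he)
      fun h e he => by simpa [mem_merge_pointed_of_mem, he] using h e he
  exact Or.inr fun e he => mem_merge_pointed_of_notMem (notMem_union_of_ne hA hB hE hEA hEB he)

theorem merge_refines (h : Refines π ν) {G : Finset (Fin n)} (hG : G ∈ ν.blocks.parts)
    (hGAB : A ∪ B ⊆ G) (hν : Inherits (A ∪ B) ν.pointed S) :
    Refines (π.merge hA hB hS hSAB) ν := by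
  refine ⟨fun C hC => ?_, fun C hC => ?_⟩ <;> rw [merge_parts] at hC <;>
    simp only [Finset.mem_insert, Finset.mem_erase] at hC <;>
    rcases hC with rfl | ⟨hCB, hCA, hC⟩
  · exact ⟨G, hG, hGAB⟩
  · exact h.1 C hC
  · exact hν.imp id fun h e he => (h e he).trans (mem_merge_pointed_of_mem he).symm
  · exact (h.2 C hC).imp id fun h e he =>
      (h e he).trans (mem_merge_pointed_of_notMem (notMem_union_of_ne hA hB hC hCA hCB he)).symm

/-- The hypothesis says that the blocks of `ρ` outside `A ∪ B` refine blocks of `π` that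
are not affected by merging `A` and `B`. -/
theorem refines_merge
    (h : ∀ E ∈ ρ.blocks.parts, E ⊆ A ∪ B ∧ Inherits E S ρ.pointed ∨
      ∃ F ∈ π.blocks.parts, F ≠ A ∧ F ≠ B ∧ E ⊆ F ∧ Inherits E π.pointed ρ.pointed) :
    Refines ρ (π.merge hA hB hS hSAB) := by
  refine ⟨fun E hE => ?_, fun E hE => ?_⟩ <;>
    rcases h E hE with ⟨hEAB, hES⟩ | ⟨F, hF, hFA, hFB, hEF, hEp⟩
  · exact ⟨A ∪ B, by simp [merge_parts], hEAB⟩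
  · exact ⟨F, by simp [merge_parts, hF, hFA, hFB], hEF⟩
  · exact hES.imp (fun h e he => (mem_merge_pointed_of_mem (hEAB he)).not.2 (h e he))
      fun h e he => (mem_merge_pointed_of_mem (hEAB he)).trans (h e he)
  · have (e) (he : e ∈ E) := mem_merge_pointed_of_notMem (hA := hA) (hB := hB) (hS := hS)
      (hSAB := hSAB)
      (notMem_union_of_ne hA hB hF hFA hFB (hEF he))
    exact hEp.imp (fun h e he => (this e he).not.2 (h e he))
      fun h e he => (this e he).trans (h e he)

end Merge

theorem eq_of_refines (h : Refines π ν)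
    (hsep : ∀ A ∈ π.blocks.parts, ∀ B ∈ π.blocks.parts, ∀ C ∈ ν.blocks.parts,
      A ⊆ C → B ⊆ C → A = B) : π = ν := by
  have hmem : ∀ B ∈ π.blocks.parts, B ∈ ν.blocks.parts := by
    intro B hB
    obtain ⟨C, hC, hBC⟩ := h.1 B hB
    suffices C ⊆ B by rwa [Finset.Subset.antisymm hBC this]
    intro e he
    obtain ⟨F, hF, heF⟩ := π.exists_block e
    obtain ⟨D, hD, hFD⟩ := h.1 F hF
    have hFC : F ⊆ C := subset_of_subset hC hD subset_rfl hFD he heF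
    rwa [hsep B hB F hF C hC hBC hFC]
  refine MultiPointedPartition.ext (Finpartition.ext ?_) (Finset.ext fun e => ?_)
  · refine Finset.Subset.antisymm hmem fun C hC => ?_
    obtain ⟨e, he, -⟩ := exists_mem_pointed hC
    obtain ⟨F, hF, heF⟩ := π.exists_block e
    rwa [ν.blocks.eq_of_mem_parts hC (hmem F hF) he heF]
  · obtain ⟨F, hF, heF⟩ := π.exists_block e
    exact (h.mem_pointed_iff hF (hmem F hF) heF).symm

theorem le_of_refines (h : Refines π ν) : π ≤ ν := by
  induction hk : π.blocks.parts.card using Nat.strong_induction_on generalizing π with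
  | _ k ih =>
  by_cases hsep : ∀ A ∈ π.blocks.parts, ∀ B ∈ π.blocks.parts, ∀ C ∈ ν.blocks.parts,
      A ⊆ C → B ⊆ C → A = B
  · exact (eq_of_refines h hsep).le
  · push Not at hsep
    obtain ⟨A, hA, B, hB, C, hC, hAC, hBC, hAB⟩ := hsep
    obtain ⟨S, hS, hSAB, hSA, hSB, hSν⟩ : ∃ S : Finset (Fin n), S.Nonempty ∧ S ⊆ A ∪ B ∧
        Inherits A S π.pointed ∧ Inherits B S π.pointed ∧ Inherits (A ∪ B) ν.pointed S := by
      by_cases hne : ((A ∪ B) ∩ ν.pointed).Nonempty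
      · exact ⟨_, hne, Finset.inter_subset_left,
          (h.2 A hA).imp (fun h e he => by simp [h e he]) (fun h e he => by simp [h e he, he]),
          (h.2 B hB).imp (fun h e he => by simp [h e he]) (fun h e he => by simp [h e he, he]),
          Or.inr fun e he => by simp [Finset.mem_union.1 he]⟩
      · obtain ⟨e, he, he'⟩ := exists_mem_pointed hA
        refine ⟨(A ∪ B) ∩ π.pointed, ⟨e, by simp [he, he']⟩, Finset.inter_subset_left,
          Or.inr fun e he => by simp [he], Or.inr fun e he => by simp [he],
          Or.inl fun e he he' => hne ⟨e, Finset.mem_inter.2 ⟨he, he'⟩⟩⟩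
    have hg : Gather π (π.merge hA hB hS hSAB) := gather_merge hAB hSA hSB
    refine Relation.ReflTransGen.head hg (ih _ (hk ▸ hg.card_lt) ?_ rfl)
    exact merge_refines h hC (Finset.union_subset hAC hBC) hSν

theorem le_iff_refines : π ≤ ν ↔ Refines π ν := by
  refine ⟨fun h => ?_, le_of_refines⟩
  change Relation.ReflTransGen Gather π ν at h
  induction h with
  | refl => exact Refines.refl π
  | tail _ hg ih => exact ih.trans hg.refines

theorem zero_le (π : MultiPointedPartition n) : zero n ≤ π := by
  refine le_of_refines ⟨fun B hB => ?_, fun B hB => ?_⟩ <;>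
    obtain ⟨a, -, rfl⟩ := Finpartition.mem_bot_iff.1 hB
  · simpa using π.exists_block a
  · by_cases h : a ∈ π.pointed
    · exact Or.inr fun e he => by simpa [zero, Finset.mem_singleton.1 he] using h
    · exact Or.inl fun e he => by simpa [Finset.mem_singleton.1 he] using h

instance : Finite (MultiPointedPartition n) :=
  Finite.of_injective (fun π : MultiPointedPartition n => (π.blocks.parts, π.pointed))
    fun π ν h => by
      simp only [Prod.mk.injEq] at h
      exact MultiPointedPartition.ext (Finpartition.ext h.1) h.2

/-! ### Semi-modularity of multi-pointed partitions -/

theorem covBy_of_refines {π ν : MultiPointedPartition n} (h : Refines π ν)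
    (hcard : π.blocks.parts.card = ν.blocks.parts.card + 1) : π ⋖ ν := by
  refine ⟨lt_of_le_of_ne (le_of_refines h) fun e => ?_, fun σ h1 h2 => ?_⟩
  · rw [e] at hcard
    omega
  · have := card_lt_of_lt h1
    have := card_lt_of_lt h2
    omega

section CommonCover

variable {t u v y : MultiPointedPartition n}

theorem exists_common_cover (hcard : u.blocks.parts.card = v.blocks.parts.card)
    (huy : Refines u y) {X Y G S : Finset (Fin n)} (hX : X ∈ u.blocks.parts)
    (hY : Y ∈ u.blocks.parts) (hXY : X ≠ Y) (hG : G ∈ y.blocks.parts) (hXG : X ⊆ G) (hYG : Y ⊆ G)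
    (hS : S.Nonempty) (hSXY : S ⊆ X ∪ Y) (hSX : Inherits X S u.pointed)
    (hSY : Inherits Y S u.pointed) (hSy : Inherits (X ∪ Y) y.pointed S)
    (hv : ∀ E ∈ v.blocks.parts, E ⊆ X ∪ Y ∧ Inherits E S v.pointed ∨
      ∃ F ∈ u.blocks.parts, F ≠ X ∧ F ≠ Y ∧ E ⊆ F ∧ Inherits E u.pointed v.pointed) :
    ∃ z, u ⋖ z ∧ v ⋖ z ∧ z ≤ y := by
  have hg : Gather u (u.merge hX hY hS hSXY) := gather_merge hXY hSX hSY
  refine ⟨u.merge hX hY hS hSXY, covBy_iff_gather.2 hg,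
    covBy_of_refines (refines_merge hv) (hcard ▸ hg.card_eq), le_of_refines ?_⟩
  exact merge_refines huy hG (Finset.union_subset hXG hYG) hSy

/-- If `y` keeps some point of `X ∪ Y`, then its pointed elements there can serve as the pointed
subset of the block `X ∪ Y`. -/
theorem exists_common_cover_of_mem (hcard : u.blocks.parts.card = v.blocks.parts.card)
    (huy : Refines u y) (hvy : Refines v y) {X Y G : Finset (Fin n)} (hX : X ∈ u.blocks.parts)
    (hY : Y ∈ u.blocks.parts) (hXY : X ≠ Y) (hG : G ∈ y.blocks.parts) (hXG : X ⊆ G) (hYG : Y ⊆ G)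
    {e : Fin n} (he : e ∈ X ∪ Y) (hey : e ∈ y.pointed)
    (hv : ∀ E ∈ v.blocks.parts, E ⊆ X ∪ Y ∨
      ∃ F ∈ u.blocks.parts, F ≠ X ∧ F ≠ Y ∧ E ⊆ F ∧ Inherits E u.pointed v.pointed) :
    ∃ z, u ⋖ z ∧ v ⋖ z ∧ z ≤ y := by
  have key {w : MultiPointedPartition n} (hwy : Refines w y) {E : Finset (Fin n)}
      (hE : E ∈ w.blocks.parts) (hEXY : E ⊆ X ∪ Y) :
      Inherits E ((X ∪ Y) ∩ y.pointed) w.pointed :=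
    (hwy.2 E hE).imp (fun h e he => by simp [h e he])
      fun h e he => by simp [h e he, Finset.mem_union.1 (hEXY he)]
  exact exists_common_cover hcard huy hX hY hXY hG hXG hYG ⟨e, Finset.mem_inter.2 ⟨he, hey⟩⟩
    Finset.inter_subset_left (key huy hX Finset.subset_union_left)
    (key huy hY Finset.subset_union_right) (Or.inr fun e he => by simp [Finset.mem_union.1 he])
    fun E hE => (hv E hE).imp (fun h => ⟨h, key hvy hE h⟩) id

/-- Two blocks of `t` are merged in `u`, and two other blocks in `v`. -/
theorem exists_common_cover_of_disjoint (hcard : u.blocks.parts.card = v.blocks.parts.card)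
    (htu : Refines t u) (htv : Refines t v) (huy : Refines u y) (hvy : Refines v y)
    {A B C D : Finset (Fin n)} (hA : A ∈ t.blocks.parts) (hB : B ∈ t.blocks.parts)
    (hC : C ∈ t.blocks.parts) (hD : D ∈ t.blocks.parts)
    (hAB : A ≠ B) (hCD : C ≠ D) (hAC : A ≠ C) (hAD : A ≠ D) (hBC : B ≠ C) (hBD : B ≠ D)
    (hu : u.blocks.parts = insert (A ∪ B) ((t.blocks.parts.erase A).erase B))
    (hv : v.blocks.parts = insert (C ∪ D) ((t.blocks.parts.erase C).erase D)) :
    ∃ z, u ⋖ z ∧ v ⋖ z ∧ z ≤ y := by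
  have hCu : C ∈ u.blocks.parts := by simp [hu, hC, hAC.symm, hBC.symm]
  have hDu : D ∈ u.blocks.parts := by simp [hu, hD, hAD.symm, hBD.symm]
  have hCDv : C ∪ D ∈ v.blocks.parts := by simp [hv]
  have hABt := union_notMem hA hB hAB
  obtain ⟨G, hG, hCDG⟩ := hvy.1 _ hCDv
  obtain ⟨e, he, hev⟩ := exists_mem_pointed hCDv
  have key {E : Finset (Fin n)} (hE : E ∈ t.blocks.parts) (hEu : E ∈ u.blocks.parts)
      (hECD : E ⊆ C ∪ D) : Inherits E ((C ∪ D) ∩ v.pointed) u.pointed :=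
    (htv.2 E hE).imp (fun h e he => by simp [h e he]) fun h e he => by
      rw [htu.mem_pointed_iff hE hEu he, ← h e he]
      simp [Finset.mem_union.1 (hECD he)]
  refine exists_common_cover (S := (C ∪ D) ∩ v.pointed) hcard huy hCu hDu hCD hG
    (Finset.union_subset_left hCDG) (Finset.union_subset_right hCDG)
    ⟨e, Finset.mem_inter.2 ⟨he, hev⟩⟩ Finset.inter_subset_left
    (key hC hCu Finset.subset_union_left) (key hD hDu Finset.subset_union_right) ?_ ?_
  · exact (hvy.2 _ hCDv).imp id fun h e he => by simp [h e he, Finset.mem_union.1 he]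
  · intro E hEv
    by_cases hECD : E = C ∪ D
    · subst hECD
      exact Or.inl ⟨subset_rfl, Or.inr fun e he => by simp [Finset.mem_union.1 he]⟩
    have hEt : E ∈ t.blocks.parts ∧ E ≠ C ∧ E ≠ D := by
      simp only [hv, Finset.mem_insert, Finset.mem_erase] at hEv
      tauto
    obtain ⟨F, hF, hEF⟩ := htu.1 E hEt.1
    right
    refine ⟨F, hF, ?_, ?_, hEF, ?_⟩
    · rintro rfl
      obtain ⟨e, he, -⟩ := exists_mem_pointed hEv
      exact hEt.2.1 (t.blocks.eq_of_mem_parts hEt.1 hC he (hEF he))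
    · rintro rfl
      obtain ⟨e, he, -⟩ := exists_mem_pointed hEv
      exact hEt.2.2 (t.blocks.eq_of_mem_parts hEt.1 hD he (hEF he))
    · exact (htu.2 E hEt.1).imp id fun h e he =>
        (h e he).trans (htv.mem_pointed_iff hEt.1 hEv he).symm

/-- The block `A` of `t` is merged with `B` in `u`, and with another block `C` in `v`. -/
theorem exists_common_cover_of_shared (hcard : u.blocks.parts.card = v.blocks.parts.card)
    (htu : Refines t u) (htv : Refines t v) (huy : Refines u y) (hvy : Refines v y)
    {A B C : Finset (Fin n)} (hA : A ∈ t.blocks.parts) (hB : B ∈ t.blocks.parts)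
    (hC : C ∈ t.blocks.parts) (hAB : A ≠ B) (hAC : A ≠ C) (hBC : B ≠ C)
    (hu : u.blocks.parts = insert (A ∪ B) ((t.blocks.parts.erase A).erase B))
    (hv : v.blocks.parts = insert (A ∪ C) ((t.blocks.parts.erase A).erase C)) :
    ∃ z, u ⋖ z ∧ v ⋖ z ∧ z ≤ y := by
  have hABu : A ∪ B ∈ u.blocks.parts := by simp [hu]
  have hACv : A ∪ C ∈ v.blocks.parts := by simp [hv]
  have hCu : C ∈ u.blocks.parts := by simp [hu, hC, hAC.symm, hBC.symm]
  have hBv : B ∈ v.blocks.parts := by simp [hv, hB, hAB.symm, hBC]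
  have hABt := union_notMem hA hB hAB
  have hne : A ∪ B ≠ C := fun h => hABt (h ▸ hC)
  obtain ⟨a, ha, -⟩ := exists_mem_pointed hA
  obtain ⟨G, hG, hABG⟩ := huy.1 _ hABu
  obtain ⟨G', hG', hACG'⟩ := hvy.1 _ hACv
  have hCG : C ⊆ G := Finset.union_subset_right (subset_of_subset hG hG' hABG hACG'
    (Finset.mem_union_left _ ha) (Finset.mem_union_left _ ha))
  have hcases : ∀ E ∈ v.blocks.parts, E = A ∪ C ∨ E = B ∨
      ∃ F ∈ u.blocks.parts, F ≠ A ∪ B ∧ F ≠ C ∧ E ⊆ F ∧ Inherits E u.pointed v.pointed := by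
    intro E hEv
    by_cases hEAC : E = A ∪ C
    · exact Or.inl hEAC
    by_cases hEB : E = B
    · exact Or.inr (Or.inl hEB)
    have hEt : E ∈ t.blocks.parts ∧ E ≠ A ∧ E ≠ C := by
      simp only [hv, Finset.mem_insert, Finset.mem_erase] at hEv
      tauto
    have hEu : E ∈ u.blocks.parts := by simp [hu, hEt, hEB]
    exact Or.inr (Or.inr ⟨E, hEu, fun h => hABt (h ▸ hEt.1), hEt.2.2, subset_rfl, Or.inr fun e he =>
      (htu.mem_pointed_iff hEt.1 hEu he).trans (htv.mem_pointed_iff hEt.1 hEv he).symm⟩)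
  by_cases hy : ∃ e ∈ A ∪ B ∪ C, e ∈ y.pointed
  · obtain ⟨e, he, hey⟩ := hy
    refine exists_common_cover_of_mem hcard huy hvy hABu hCu hne hG hABG hCG he hey fun E hE => ?_
    rcases hcases E hE with rfl | rfl | h
    · left; grind
    · left; grind
    · exact Or.inr h
  -- Otherwise `y` drops `A`, `B` and `C`, and it suffices to find a pointed subset of `A ∪ B ∪ C`
  -- that can be obtained both from `u` and from `v`.
  have hyS (S) : Inherits (A ∪ B ∪ C) y.pointed S := Or.inl fun e he he' => hy ⟨e, he, he'⟩
  have dAB : ∀ e ∈ A, e ∉ B := fun e => notMem_of_ne hA hB hAB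
  have dAC : ∀ e ∈ A, e ∉ C := fun e => notMem_of_ne hA hC hAC
  have dBC : ∀ e ∈ B, e ∉ C := fun e => notMem_of_ne hB hC hBC
  have uC : ∀ e ∈ C, (e ∈ u.pointed ↔ e ∈ t.pointed) := fun e he => htu.mem_pointed_iff hC hCu he
  have vB : ∀ e ∈ B, (e ∈ v.pointed ↔ e ∈ t.pointed) := fun e he => htv.mem_pointed_iff hB hBv he
  have uB := htu.2 B hB
  have vC := htv.2 C hC
  obtain ⟨S, hS, hSW, hSAB, hSC, hSAC, hSB⟩ : ∃ S : Finset (Fin n), S.Nonempty ∧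
      S ⊆ A ∪ B ∪ C ∧ Inherits (A ∪ B) S u.pointed ∧ Inherits C S u.pointed ∧
      Inherits (A ∪ C) S v.pointed ∧ Inherits B S v.pointed := by
    rcases htu.2 A hA with uA | uA
    · obtain ⟨f, hf, hf'⟩ := exists_mem_pointed hABu
      refine ⟨(A ∪ B) ∩ u.pointed, ⟨f, Finset.mem_inter.2 ⟨hf, hf'⟩⟩, by grind, ?_, ?_, ?_, ?_⟩
      · right; grind
      · left; grind
      · left; grind
      · exact uB.imp (by grind) (by grind)
    rcases htv.2 A hA with vA | vA
    · obtain ⟨f, hf, hf'⟩ := exists_mem_pointed hACv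
      refine ⟨(A ∪ C) ∩ v.pointed, ⟨f, Finset.mem_inter.2 ⟨hf, hf'⟩⟩, by grind, ?_, ?_, ?_, ?_⟩
      · left; grind
      · exact vC.imp (by grind) (by grind)
      · right; grind
      · left; grind
    · obtain ⟨f, hf, hf'⟩ := exists_mem_pointed hABu
      refine ⟨(A ∪ B) ∩ u.pointed ∪ (A ∪ C) ∩ v.pointed,
        ⟨f, Finset.mem_union_left _ (Finset.mem_inter.2 ⟨hf, hf'⟩)⟩, by grind, ?_, ?_, ?_, ?_⟩
      · right; grind
      · exact vC.imp (by grind) (by grind)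
      · right; grind
      · exact uB.imp (by grind) (by grind)
  refine exists_common_cover hcard huy hABu hCu hne hG hABG hCG hS hSW hSAB hSC (hyS S)
    fun E hE => ?_
  rcases hcases E hE with rfl | rfl | h
  · exact Or.inl ⟨by grind, hSAC⟩
  · exact Or.inl ⟨by grind, hSB⟩
  · exact Or.inr h

/-- The same two blocks of `t` are merged in `u` and `v`, with different pointed subsets. Then
`y` drops both, so the block of `y` containing them contains another block that `y` keeps. -/
theorem exists_common_cover_of_eq (hcard : u.blocks.parts.card = v.blocks.parts.card)
    (htu : Refines t u) (htv : Refines t v) (huy : Refines u y) (hvy : Refines v y) (huv : u ≠ v)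
    {A B : Finset (Fin n)}
    (hu : u.blocks.parts = insert (A ∪ B) ((t.blocks.parts.erase A).erase B))
    (hv : v.blocks.parts = insert (A ∪ B) ((t.blocks.parts.erase A).erase B)) :
    ∃ z, u ⋖ z ∧ v ⋖ z ∧ z ≤ y := by
  have hABu : A ∪ B ∈ u.blocks.parts := by simp [hu]
  have hABv : A ∪ B ∈ v.blocks.parts := by simp [hv]
  have hE {E : Finset (Fin n)} (hE : E ∈ v.blocks.parts) (hEAB : E ≠ A ∪ B) :
      E ∈ u.blocks.parts ∧ ∀ e ∈ E, (e ∈ u.pointed ↔ e ∈ v.pointed) := by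
    have hEu : E ∈ u.blocks.parts := by rwa [hu, ← hv]
    have hEt : E ∈ t.blocks.parts := by
      simp only [hv, Finset.mem_insert, Finset.mem_erase] at hE
      tauto
    exact ⟨hEu, fun e he =>
      (htu.mem_pointed_iff hEt hEu he).trans (htv.mem_pointed_iff hEt hE he).symm⟩
  have hdrop : ∀ e ∈ A ∪ B, e ∉ y.pointed := by
    intro e he hey
    refine huv (MultiPointedPartition.ext (Finpartition.ext (hu.trans hv.symm))
      (Finset.ext fun f => ?_))
    obtain ⟨F, hF, hfF⟩ := v.exists_block f
    by_cases hFAB : F = A ∪ B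
    · subst hFAB
      have h1 := (huy.2 _ hABu).resolve_left (fun h => h e he hey) f hfF
      have h2 := (hvy.2 _ hABv).resolve_left (fun h => h e he hey) f hfF
      exact h1.symm.trans h2
    · exact (hE hF hFAB).2 f hfF
  obtain ⟨G, hG, hABG⟩ := huy.1 _ hABu
  obtain ⟨e, heG, hey⟩ := exists_mem_pointed hG
  obtain ⟨F, hF, heF⟩ := u.exists_block e
  obtain ⟨G', hG', hFG'⟩ := huy.1 F hF
  refine exists_common_cover_of_mem hcard huy hvy hABu hF (fun h => hdrop e (h ▸ heF) hey) hG hABG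
    (subset_of_subset hG hG' subset_rfl hFG' heG heF) (Finset.mem_union_right _ heF) hey
    fun E hEv => ?_
  by_cases hEAB : E = A ∪ B
  · exact Or.inl (hEAB ▸ Finset.subset_union_left)
  by_cases hEF : E = F
  · exact Or.inl (hEF ▸ Finset.subset_union_right)
  exact Or.inr ⟨E, (hE hEv hEAB).1, hEAB, hEF, subset_rfl, Or.inr (hE hEv hEAB).2⟩

end CommonCover

theorem isIntervalSemimodular (n : ℕ) : IsIntervalSemimodular (MultiPointedPartition n) := by
  intro t u v y htu htv huv huy hvy
  rw [covBy_iff_gather] at htu htv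
  rw [le_iff_refines] at huy hvy
  have hcard : u.blocks.parts.card = v.blocks.parts.card := by
    have := htu.card_eq
    have := htv.card_eq
    omega
  have htu' := htu.refines
  have htv' := htv.refines
  obtain ⟨A, hA, B, hB, hAB, hu, -⟩ := htu
  obtain ⟨C, hC, D, hD, hCD, hv, -⟩ := htv
  have hu' : u.blocks.parts = insert (B ∪ A) ((t.blocks.parts.erase B).erase A) := by
    rw [hu, Finset.union_comm, Finset.erase_right_comm]
  have hv' : v.blocks.parts = insert (D ∪ C) ((t.blocks.parts.erase D).erase C) := by
    rw [hv, Finset.union_comm, Finset.erase_right_comm]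
  by_cases hAC : A = C
  · subst hAC
    by_cases hBD : B = D
    · subst hBD
      exact exists_common_cover_of_eq hcard htu' htv' huy hvy huv hu hv
    · exact exists_common_cover_of_shared hcard htu' htv' huy hvy hA hB hD hAB hCD hBD hu hv
  by_cases hAD : A = D
  · subst hAD
    by_cases hBC : B = C
    · subst hBC
      exact exists_common_cover_of_eq hcard htu' htv' huy hvy huv hu hv'
    · exact exists_common_cover_of_shared hcard htu' htv' huy hvy hA hB hC hAB hAC hBC hu hv'
  by_cases hBC : B = C
  · subst hBC
    exact exists_common_cover_of_shared hcard htu' htv' huy hvy hB hA hD hAB.symm hCD hAD hu' hv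
  by_cases hBD : B = D
  · subst hBD
    exact exists_common_cover_of_shared hcard htu' htv' huy hvy hB hA hC hAB.symm hBC hAC hu' hv'
  exact exists_common_cover_of_disjoint hcard htu' htv' huy hvy hA hB hC hD hAB hCD hAC hAD hBC
    hBD hu hv

/-- The number of gatherings needed to reach `π` from the least element. -/
def rank (π : MultiPointedPartition n) : ℕ :=
  n - π.blocks.parts.card

theorem card_parts_le (π : MultiPointedPartition n) : π.blocks.parts.card ≤ n := by
  simpa using π.blocks.card_parts_le_card

theorem rank_eq_of_covBy {π ν : MultiPointedPartition n} (h : π ⋖ ν) : ν.rank = π.rank + 1 := by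
  have := (covBy_iff_gather.1 h).card_eq
  have := π.card_parts_le
  simp only [rank]
  omega

theorem rank_strictMono : StrictMono (rank (n := n)) := by
  intro π ν h
  have := card_lt_of_lt h
  have := π.card_parts_le
  simp only [rank]
  omega

end MultiPointedPartition

theorem mainTheorem7 (n i : ℕ) (hi : 1 ≤ i) (hin : i ≤ n) (V : MultiPointedPartition n)
    (hV : V.blocks.parts.card = 1) (hVi : V.pointed.card = i) :
    IsTotallySemimodularPoset V.IntervalBelow ∧
    IsCLShellable V.IntervalBelow ∧
    IsCohenMacaulayPoset ℤ V.IntervalBelow ∧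
    ∀ (K : Type*) [Field K], IsCohenMacaulayPoset K V.IntervalBelow := by
  have hP : IsIntervalSemimodular V.IntervalBelow :=
    (MultiPointedPartition.isIntervalSemimodular n).icc _ _
  have hb : IsBoundedPoset V.IntervalBelow := isBoundedPoset_Icc V.zero_le
  have hρ : ∀ a b : V.IntervalBelow, a ⋖ b → b.1.rank = a.1.rank + 1 := fun a b h =>
    MultiPointedPartition.rank_eq_of_covBy (coe_covBy_coe_Icc.2 h)
  have hmono : StrictMono fun a : V.IntervalBelow => a.1.rank := fun a b h =>
    MultiPointedPartition.rank_strictMono h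
  exact ⟨hP.isTotallySemimodularPoset hb, hP.isCLShellable ⟨hb, isPurePoset_of_rank hρ⟩,
    hP.isCohenMacaulayPoset hb hρ hmono, fun K _ => hP.isCohenMacaulayPoset hb hρ hmono⟩
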